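/- **Landscape of Boosting Robustness.** Let $\mathcal X$ be a measurable space (the instance space), $\mathcal Y$ a label space with exactly two labels, $\mathcal U:\mathcal X\to 2^{\mathcal X}$ a perturbation set with $\mathcal U(x)\neq\emptyset$ for every $x$, and $\mathcal C$ a class of (measurable) concepts $c:\mathcal X\to\mathcal Y$. Put $\mathcal U^{-1}(\mathcal U)(x)=\{\tilde x:\mathcal U(x)\cap\mathcal U(\tilde x)\neq\emptyset\}$. A probability distribution $D$ over $\mathcal X$ is *robustly realizable* by $c$ if $\Pr_{x\sim D}[\exists z\in\mathcal U(x): c(z)\neq c(x)]=0$. A learner is a map from finite labelled samples to predictors $\mathcal X\to\mathcal Y$. * $\mathcal C$ is *$(\epsilon,\delta)$-robustly learnable w.r.t. $\mathcal U$* if there are a learner $\mathbb B$ and a sample size $m\in\mathbb N$ such that for every $c\in\mathcal C$ and every $D$ robustly realizable by $c$, with probability at least $1-\delta$ over $S=\{(x_i,c(x_i))\}_{i=1}^m$ with $x_1,\dots,x_m\sim D$ i.i.d., the predictor $\hat h=\mathbb B(S)$ satisfies $\Pr_{x\sim D}[\exists z\in\mathcal U(x):\hat h(z)\neq c(x)]\le\epsilon$.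 * $\mathcal C$ is *$(\beta,\epsilon,\delta)$-barely-robustly learnable w.r.t. $\mathcal U^{-1}(\mathcal U)$* if there are a learner $\mathbb A$ and a sample size $m\in\mathbb N$ such that for every $c\in\mathcal C$ and every $D$ robustly realizable by $c$ (w.r.t. $\mathcal U$), with probability at least $1-\delta$ over $S$ as above, $\hat h=\mathbb A(S)$ satisfies $\Pr_{x\sim D}[\forall\tilde x\in\mathcal U^{-1}(\mathcal U)(x):\hat h(\tilde x)=\hat h(x)]\ge\beta$ and $\Pr_{x\sim D}[\hat h(x)\neq c(x)]\le\epsilon$. (In these definitions, probabilities of events that may fail to be measurable are bounded through events, universally measurable jointly in the labelled sample and the test example, that contain the loss events, respectively are contained in the robustness event. When the events themselves are universally measurable this is the plain reading.) Let $\epsilon_0=\delta_0=\tfrac13$. Then: 1. For every $0<\beta\le1$: if $\mathcal C$ is $\bigl(\beta,\frac{\beta\epsilon_0}{2},\frac{\beta\delta_0}{\ln(2/\epsilon_0)}\bigr)$-barely-robustly learnable w.r.t. $\mathcal U^{-1}(\mathcal U)$, then $\mathcal C$ is $(\epsilon_0,\delta_0)$-robustly learnable w.r.t. $\mathcal U$.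 2. For all targets $\epsilon,\delta\in(0,1)$: if $\mathcal C$ is $(\epsilon_0,\delta_0)$-robustly learnable w.r.t. $\mathcal U$, then $\mathcal C$ is $(\epsilon,\delta)$-robustly learnable w.r.t. $\mathcal U$. 3. For all $\epsilon,\delta\in(0,1)$: if $\mathcal C$ is $(\epsilon,\delta)$-robustly learnable w.r.t. $\mathcal U$, then $\mathcal C$ is $\bigl(\frac{1-\epsilon}{2},2\epsilon,2\delta\bigr)$-barely-robustly learnable w.r.t. $\mathcal U^{-1}(\mathcal U)$. In particular, robustness w.r.t. $\mathcal U^{-1}(\mathcal U)$ can also be boosted: for every $0<\beta\le1$ and all $\epsilon,\delta\in(0,1)$, if $\mathcal C$ is $\bigl(\beta,\frac{\beta\epsilon_0}{2},\frac{\beta\delta_0}{\ln(2/\epsilon_0)}\bigr)$-barely-robustly learnable w.r.t. $\mathcal U^{-1}(\mathcal U)$, then it is $\bigl(\frac{1-\epsilon}{2},2\epsilon,2\delta\bigr)$-barely-robustly learnable w.r.t. $\mathcal U^{-1}(\mathcal U)$. -/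

import Mathlib

open MeasureTheory

namespace BarelyRobust

variable {X Y : Type*}

/-- The set `U⁻¹(U)(x)` of all `x'` that share some perturbation with `x`. -/
def sharedPert (U : X → Set X) (x : X) : Set X :=
  {x' | ∃ z, z ∈ U x ∧ z ∈ U x'}

/-- The robust region of a predictor `h` with respect to a perturbation set `V`. -/
def Rob (V : X → Set X) (h : X → Y) : Set X :=
  {x | ∀ z ∈ V x, h z = h x}

/-- A learner maps a finite labelled sample of any size to a predictor. -/
abbrev Learner (X Y : Type*) := (m : ℕ) → (Fin m → X × Y) → (X → Y)

/-- The sample `S` labelled by the concept `c`. -/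
def labelled (c : X → Y) {m : ℕ} (S : Fin m → X) : Fin m → X × Y :=
  fun i => (S i, c (S i))

/-- Universal measurability: the set is measurable for the completion of every finite measure. -/
def UnivMeasurableSet {α : Type*} [MeasurableSpace α] (s : Set α) : Prop :=
  ∀ μ : Measure α, IsFiniteMeasure μ → NullMeasurableSet s μ

/-- `D` is robustly realizable by `c`: `P_{x ∼ D}[∃ z ∈ U x, c z ≠ c x] = 0`. -/
def RobustlyRealizable [MeasurableSpace X] (U : X → Set X) (c : X → Y) (D : Measure X) : Prop :=
  D {x | ∃ z ∈ U x, c z ≠ c x} = 0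

/-- `C` is `(ε, δ)`-robustly learnable with respect to `U`: one learner `A` with one sample size `m`
satisfies, for every `c ∈ C` and every distribution `D` robustly realizable by `c`, with
probability at least `1 - δ` over `S ∼ D ^ m` labelled by `c`,
`P_{x ∼ D}[∃ z ∈ U x, A(S) z ≠ c x] ≤ ε`.

The robust loss event `{(S, (x, y)) | ∃ z ∈ U x, A(S) z ≠ y}` is a projection, so it may fail to be
measurable. Its probability is bounded through a universally measurable event `L` that contains it.
If the loss event itself is universally measurable, one may take `L` equal to it. -/
def RobustlyLearnable [MeasurableSpace X] [MeasurableSpace Y]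
    (U : X → Set X) (ε δ : ℝ) (C : Set (X → Y)) : Prop :=
  ∃ (A : Learner X Y) (m : ℕ) (L : Set ((Fin m → X × Y) × (X × Y))),
    UnivMeasurableSet L ∧
    (∀ S x y, (∃ z ∈ U x, A m S z ≠ y) → (S, (x, y)) ∈ L) ∧
    ∀ c ∈ C, ∀ D : Measure X, IsProbabilityMeasure D → RobustlyRealizable U c D →
      Measure.pi (fun _ : Fin m => D)
        {S | ¬ D {x | (labelled c S, (x, c x)) ∈ L} ≤ ENNReal.ofReal ε} ≤ ENNReal.ofReal δ

/-- `C` is `(β, ε, δ)`-barely-robustly learnable with respect to `U⁻¹(U)`: one learner `A` with one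
sample size `m` satisfies, for every `c ∈ C` and every distribution `D` robustly realizable by `c`
(with respect to `U`), with probability at least `1 - δ` over `S ∼ D ^ m` labelled by `c`,
`P_{x ∼ D}[x ∈ Rob_{U⁻¹(U)}(A(S))] ≥ β` and `P_{x ∼ D}[A(S) x ≠ c x] ≤ ε`.

As above, the probability of the robust region is bounded from below through a universally
measurable event `R` contained in it, and that of the error event from above through a universally
measurable event `E` that contains it; when these events are universally measurable, one may take
`R` and `E` equal to them. -/
def BarelyRobustlyLearnable [MeasurableSpace X] [MeasurableSpace Y]
    (U : X → Set X) (β ε δ : ℝ) (C : Set (X → Y)) : Prop :=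
  ∃ (A : Learner X Y) (m : ℕ) (R : Set ((Fin m → X × Y) × X))
    (E : Set ((Fin m → X × Y) × (X × Y))),
    UnivMeasurableSet R ∧ UnivMeasurableSet E ∧
    (∀ S x, (S, x) ∈ R → x ∈ Rob (sharedPert U) (A m S)) ∧
    (∀ S x y, A m S x ≠ y → (S, (x, y)) ∈ E) ∧
    ∀ c ∈ C, ∀ D : Measure X, IsProbabilityMeasure D → RobustlyRealizable U c D →
      Measure.pi (fun _ : Fin m => D)
        {S | ¬ (ENNReal.ofReal β ≤ D {x | (labelled c S, x) ∈ R} ∧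
                D {x | (labelled c S, (x, c x)) ∈ E} ≤ ENNReal.ofReal ε)} ≤ ENNReal.ofReal δ

end BarelyRobust

/-!
Every predictor in the proof is built from a tuple of sample points, so learning is reduced to a
statement about finitely many weighted points, `WeakCompression`, and back.

*From a learner to compression.*  Robustly labelled points `x i` with weights `P` carry an empirical
distribution, which is again robustly realizable.  A learner whose failure probability is less than
one has a successful run on it, and that run sees a tuple of these points.  For a robust learner
this is `RobustlyLearnable.weakCompression`.  For a barely robust learner, it yields a predictor `h`
that is robust with respect to `U⁻¹(U)` on a fraction `β` of the weight.  If `h` is robust at `x`,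
it gives the same label to all points sharing a perturbation `z ∈ U x` with `x`; so a cascade may
answer at `z` with `h` if `h` agrees on all points of which `z` is a perturbation, and defer to the
next predictor, trained on the weights outside the robust region, otherwise.  One round turns a
loss level `θ` into `ε + (1 - β) θ` (`WeakCompression.cascade`), and for `ε = β / 6` the levels
decrease to `1 / 6`.  Since only the existence of a successful run matters, neither rejection
sampling nor a union bound over the rounds is needed.

*From compression to a robust learner.*  If the loss level is less than `1 / 2`, multiplicative
weights combine `O(log M)` predictors, each given by boundedly many points, to a majority vote
without robust loss on all of the `M` given points (`WeakCompression.exists_consistent`).  A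
predictor determined by `k` of the `M` sample points that has no loss on the other ones has loss
greater than `ε` with probability at most `(1 - ε) ^ (M - k)` (`pi_miss_le`), and the union bound
over the `M ^ k` tuples is affordable for `k = O(log M)` (`WeakCompression.robustlyLearnable`).

*From a robust to a barely robust learner.*  Let `h` have small robust loss and let `y` be the
majority label of the sample, which is nearly a majority label of the distribution by Chebyshev's
inequality.  Predicting `y` at `x` if and only if `h` takes the value `y` somewhere on `U x` is
correct where `h` is robustly correct, and robust with respect to `U⁻¹(U)` where `h` robustly
predicts `y` (`WeakCompression.barelyRobustlyLearnable`).  If `ε ≥ 1 / 2`, the error bound `2 ε` is vacuous and a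
constant predictor will do.

Measurability: a choice of a tuple that depends on the sample only through finitely many universally
measurable events produces universally measurable events again (`UnivMeasurableSet.boolean`).
-/

namespace BarelyRobust

/-! ### Universally measurable sets and weak robust compression -/

section UnivMeasurable

variable {α β : Type*} [MeasurableSpace α] [MeasurableSpace β]

theorem _root_.MeasurableSet.univMeasurableSet {s : Set α} (hs : MeasurableSet s) :
    UnivMeasurableSet s :=
  fun _ _ => hs.nullMeasurableSet

theorem UnivMeasurableSet.compl {s : Set α} (hs : UnivMeasurableSet s) : UnivMeasurableSet sᶜ :=
  fun μ hμ => (hs μ hμ).compl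

theorem UnivMeasurableSet.iUnion {ι : Type*} [Countable ι] {s : ι → Set α}
    (hs : ∀ i, UnivMeasurableSet (s i)) : UnivMeasurableSet (⋃ i, s i) :=
  fun μ hμ => .iUnion fun i => hs i μ hμ

theorem UnivMeasurableSet.iInter {ι : Type*} [Countable ι] {s : ι → Set α}
    (hs : ∀ i, UnivMeasurableSet (s i)) : UnivMeasurableSet (⋂ i, s i) :=
  fun μ hμ => .iInter fun i => hs i μ hμ

theorem UnivMeasurableSet.union {s t : Set α} (hs : UnivMeasurableSet s)
    (ht : UnivMeasurableSet t) : UnivMeasurableSet (s ∪ t) :=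
  fun μ hμ => (hs μ hμ).union (ht μ hμ)

theorem UnivMeasurableSet.inter {s t : Set α} (hs : UnivMeasurableSet s)
    (ht : UnivMeasurableSet t) : UnivMeasurableSet (s ∩ t) :=
  fun μ hμ => (hs μ hμ).inter (ht μ hμ)

/-- The preimage is null measurable for `μ` because the set itself is null measurable for the
image of `μ`. -/
theorem UnivMeasurableSet.preimage {s : Set β} (hs : UnivMeasurableSet s) {f : α → β}
    (hf : Measurable f) : UnivMeasurableSet (f ⁻¹' s) := fun μ _ =>
  (hs (μ.map f) inferInstance).preimage ⟨hf, Measure.AbsolutelyContinuous.rfl⟩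

/-- Any Boolean combination of finitely many universally measurable sets is universally
measurable. -/
theorem UnivMeasurableSet.boolean {ι : Type*} [Finite ι] {s : ι → Set α}
    (hs : ∀ i, UnivMeasurableSet (s i)) (Φ : Set ι → Prop) :
    UnivMeasurableSet {a | Φ {i | a ∈ s i}} := by
  have key : {a | Φ {i | a ∈ s i}} =
      ⋃ F : {F : Set ι // Φ F}, ⋂ i, {a | a ∈ s i ↔ i ∈ F.1} := by
    ext a
    simp only [Set.mem_ofPred_eq, Set.mem_iUnion, Set.mem_iInter, Subtype.exists]
    constructor
    · exact fun h => ⟨_, h, fun i => Iff.rfl⟩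
    · rintro ⟨F, hF, h⟩
      rwa [show {i | a ∈ s i} = F from Set.ext h]
  rw [key]
  refine .iUnion fun F => .iInter fun i => ?_
  by_cases hi : i ∈ F.1
  · simpa [hi] using hs i
  · have := (hs i).compl
    simp only [hi, iff_false]
    exact this

end UnivMeasurable

/-- **Weak robust compression** with loss level `θ`.  A predictor `A K` is computed from a finite
tuple `K` of labelled examples.  Whatever points `x i`, robustly labelled by a concept `c ∈ C`, and
whatever weights `P` on their indices, some tuple of these very points yields a predictor whose
robust loss, witnessed by the universally measurable event `L`, has weighted frequency at most `θ`.

That the points are robustly labelled is expressed by a measurable set `N` that they avoid and that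
contains every point not robustly labelled: points need not be measurable, so a single point outside
the latter set might still charge it. -/
def WeakCompression {X Y : Type*} [MeasurableSpace X] [MeasurableSpace Y]
    (U : X → Set X) (θ : ℝ) (C : Set (X → Y)) : Prop :=
  ∃ (κ : Type) (_ : Fintype κ) (A : (κ → X × Y) → X → Y) (L : Set ((κ → X × Y) × (X × Y))),
    UnivMeasurableSet L ∧
    (∀ K x y, (∃ z ∈ U x, A K z ≠ y) → (K, (x, y)) ∈ L) ∧
    ∀ c ∈ C, ∀ N : Set X, MeasurableSet N → {x | ∃ z ∈ U x, c z ≠ c x} ⊆ N →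
      ∀ (ι : Type) [Finite ι] [Nonempty ι] [MeasurableSpace ι] [DiscreteMeasurableSpace ι]
        (x : ι → X), (∀ i, x i ∉ N) → ∀ (P : Measure ι) [IsFiniteMeasure P],
        ∃ J : κ → ι, P.real {i | ((fun j => (x (J j), c (x (J j)))), (x i, c (x i))) ∈ L} ≤
          θ * P.real Set.univ

/-! ### From learners to weak robust compression -/

section Empirical

variable {X Y : Type*} [MeasurableSpace X] {ι : Type} [MeasurableSpace ι]
  [DiscreteMeasurableSpace ι]

/-- The distribution of `x i` when the index `i` is drawn with probability proportional to the
weights `P`. -/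
noncomputable def empirical (P : Measure ι) (x : ι → X) : Measure X :=
  ((P Set.univ)⁻¹ • P).map x

theorem isProbabilityMeasure_empirical {P : Measure ι} [IsFiniteMeasure P] (hP : P ≠ 0)
    (x : ι → X) : IsProbabilityMeasure (empirical P x) := by
  have : NeZero P := ⟨hP⟩
  exact Measure.isProbabilityMeasure_map Measurable.of_discrete.aemeasurable

theorem robustlyRealizable_empirical {U : X → Set X} {c : X → Y} {N : Set X}
    (hN : MeasurableSet N) (hbad : {x | ∃ z ∈ U x, c z ≠ c x} ⊆ N) {x : ι → X}
    (hx : ∀ i, x i ∉ N) (P : Measure ι) : RobustlyRealizable U c (empirical P x) := by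
  refine measure_mono_null hbad ?_
  rw [empirical, Measure.map_apply Measurable.of_discrete hN]
  convert measure_empty (μ := (P Set.univ)⁻¹ • P)
  ext i
  simpa using hx i

theorem real_preimage_le_of_empirical_le {P : Measure ι} [IsFiniteMeasure P] (hP : P ≠ 0)
    {x : ι → X} {s : Set X} {ε : ℝ} (hε : 0 ≤ ε) (h : empirical P x s ≤ ENNReal.ofReal ε) :
    P.real (x ⁻¹' s) ≤ ε * P.real Set.univ := by
  have h1 := (Measure.le_map_apply (μ := (P Set.univ)⁻¹ • P)
    (Measurable.of_discrete (f := x)).aemeasurable s).trans h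
  have h0 : P Set.univ ≠ 0 := by simpa using hP
  rw [Measure.smul_apply, smul_eq_mul, mul_comm, ← div_eq_mul_inv,
    ENNReal.div_le_iff h0 (measure_ne_top _ _)] at h1
  have h2 := ENNReal.toReal_mono (ENNReal.mul_ne_top ENNReal.ofReal_ne_top (measure_ne_top _ _)) h1
  rwa [ENNReal.toReal_mul, ENNReal.toReal_ofReal hε] at h2

theorem le_real_preimage_of_le_empirical {P : Measure ι} [IsFiniteMeasure P] (hP : P ≠ 0)
    {x : ι → X} {s : Set X} (hs : UnivMeasurableSet s) {β : ℝ} (hβ : 0 ≤ β)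
    (h : ENNReal.ofReal β ≤ empirical P x s) :
    β * P.real Set.univ ≤ P.real (x ⁻¹' s) := by
  have := isProbabilityMeasure_empirical hP x
  have h0 : P Set.univ ≠ 0 := by simpa using hP
  rw [empirical, Measure.map_apply₀ Measurable.of_discrete.aemeasurable
    (hs (empirical P x) inferInstance), Measure.smul_apply, smul_eq_mul, mul_comm,
    ← div_eq_mul_inv, ENNReal.le_div_iff_mul_le (.inl h0) (.inl (measure_ne_top _ _))] at h
  have h2 := ENNReal.toReal_mono (measure_ne_top _ _) h
  rwa [ENNReal.toReal_mul, ENNReal.toReal_ofReal hβ] at h2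

/-- An event of probability less than one under i.i.d. sampling from the empirical distribution is
avoided by some resample of the given points.  The detour through indices is needed because the
set of resamples need not be measurable. -/
theorem exists_resample_notMem {P : Measure ι} [IsFiniteMeasure P] (hP : P ≠ 0) (x : ι → X)
    {m : ℕ} {F : Set (Fin m → X)} (hF : Measure.pi (fun _ : Fin m => empirical P x) F < 1) :
    ∃ J : Fin m → ι, (fun j => x (J j)) ∉ F := by
  have : NeZero P := ⟨hP⟩
  have := isProbabilityMeasure_empirical hP x
  by_contra! h
  refine hF.not_ge ?_
  have hx : Measurable x := .of_discrete
  have hmap := Measure.pi_map_pi (μ := fun _ : Fin m => (P Set.univ)⁻¹ • P) (f := fun _ => x)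
    (hμ := fun _ => by
      have : IsProbabilityMeasure (((P Set.univ)⁻¹ • P).map x) := this
      infer_instance)
    (fun _ => hx.aemeasurable)
  have hle := Measure.le_map_apply (μ := Measure.pi fun _ : Fin m => (P Set.univ)⁻¹ • P)
    (f := fun (J : Fin m → ι) j => x (J j))
    (measurable_pi_lambda _ fun j => hx.comp (measurable_pi_apply j)).aemeasurable F
  rw [hmap] at hle
  refine le_trans (le_of_eq ?_) hle
  rw [show (fun (J : Fin m → ι) j => x (J j)) ⁻¹' F = Set.univ from Set.eq_univ_of_forall h,
    measure_univ]

end Empirical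

section Cascade

variable {X Y : Type*} {U : X → Set X}

open Classical in
/-- The selective cascade of `h` and `g`: the label that `h` gives to all the points of which `z` is
a perturbation, if `h` agrees on them, and `g z` otherwise. -/
noncomputable def cascade (U : X → Set X) (h g : X → Y) (z : X) : Y :=
  if H : ∃ y, ∀ x, z ∈ U x → h x = y then H.choose else g z

/-- At a point `x` that `h` labels correctly, the cascade is robustly correct as soon as `g` is, and
even without that if `h` is robust at `x`. -/
theorem cascade_eq {h g : X → Y} {x z : X} (hz : z ∈ U x)
    (hg : x ∉ Rob (sharedPert U) h → g z = h x) : cascade U h g z = h x := by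
  unfold cascade
  split_ifs with H
  · exact (H.choose_spec x hz).symm
  · exact hg fun hx => H ⟨h x, fun x' hx' => hx x' ⟨z, hz, hx'⟩⟩

end Cascade

section Weak

variable {X Y : Type*} [MeasurableSpace X] [MeasurableSpace Y] {U : X → Set X} {C : Set (X → Y)}

theorem WeakCompression.mono {θ θ' : ℝ} (h : WeakCompression U θ C) (hθ : θ ≤ θ') :
    WeakCompression U θ' C := by
  obtain ⟨κ, _, A, L, hL, hA, hC⟩ := h
  refine ⟨κ, inferInstance, A, L, hL, hA, fun c hc N hN hb ι _ _ _ _ x hx P _ => ?_⟩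
  obtain ⟨J, hJ⟩ := hC c hc N hN hb ι x hx P
  exact ⟨J, hJ.trans (by gcongr)⟩

theorem weakCompression_one [Nonempty Y] : WeakCompression U 1 C := by
  refine ⟨Empty, inferInstance, fun _ _ => Classical.arbitrary Y, Set.univ,
    MeasurableSet.univ.univMeasurableSet, fun _ _ _ _ => trivial,
    fun c _ N _ _ ι _ _ _ _ x _ P _ => ⟨Empty.elim, ?_⟩⟩
  rw [one_mul]
  exact measureReal_mono (Set.subset_univ _)

/-- On the empirical distribution of robustly labelled points, a robust learner with any positive
probability of success has a successful run, and that run sees a tuple of these points. -/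
theorem RobustlyLearnable.weakCompression {ε δ : ℝ} (hε : 0 ≤ ε) (hδ : δ < 1)
    (h : RobustlyLearnable U ε δ C) : WeakCompression U ε C := by
  obtain ⟨A, m, L, hL, hA, hC⟩ := h
  refine ⟨Fin m, inferInstance, A m, L, hL, hA, fun c hc N hN hb ι _ _ _ _ x hx P _ => ?_⟩
  by_cases hP : P = 0
  · exact ⟨fun _ => Classical.arbitrary ι, by simp [hP]⟩
  obtain ⟨J, hJ⟩ := exists_resample_notMem hP x <|
    (hC c hc _ (isProbabilityMeasure_empirical hP x)
      (robustlyRealizable_empirical hN hb hx P)).trans_lt (ENNReal.ofReal_lt_one.2 hδ)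
  exact ⟨J, real_preimage_le_of_empirical_le hP
    (s := {x' | (labelled c fun j => x (J j), (x', c x')) ∈ L}) hε (not_not.1 hJ)⟩

/-- One round of boosting.  The cascade errs only where the barely robust predictor errs, which has
weight at most `ε`, or where that predictor is not robust and the next one errs.  The next predictor
is trained on the weights outside the robust region. -/
theorem WeakCompression.cascade {β ε δ θ : ℝ} (hβ : 0 ≤ β) (hε : 0 ≤ ε) (hδ : δ < 1)
    (hθ : 0 ≤ θ) (hweak : WeakCompression U θ C) (h : BarelyRobustlyLearnable U β ε δ C) :
    WeakCompression U (ε + θ * (1 - β)) C := by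
  obtain ⟨κ, _, B, L, hL, hB, hBC⟩ := hweak
  obtain ⟨A, m, R, E, hR, hE, hAR, hAE, hAC⟩ := h
  have mE : Measurable fun p : ((Fin m ⊕ κ → X × Y) × (X × Y)) =>
      ((fun j => p.1 (.inl j) : Fin m → X × Y), p.2) := by fun_prop
  have mR : Measurable fun p : ((Fin m ⊕ κ → X × Y) × (X × Y)) =>
      ((fun j => p.1 (.inl j) : Fin m → X × Y), p.2.1) := by fun_prop
  have mL : Measurable fun p : ((Fin m ⊕ κ → X × Y) × (X × Y)) =>
      ((fun j => p.1 (.inr j) : κ → X × Y), p.2) := by fun_prop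
  refine ⟨Fin m ⊕ κ, inferInstance, fun K =>
      BarelyRobust.cascade U (A m fun j => K (.inl j)) (B fun j => K (.inr j)), _,
    (hE.preimage mE).union ((hR.preimage mR).compl.inter (hL.preimage mL)), ?_, ?_⟩
  · rintro K x y ⟨z, hz, hne⟩
    by_contra hcon
    simp only [Set.mem_union, Set.mem_inter_iff, Set.mem_preimage, Set.mem_compl_iff, not_or,
      not_and] at hcon
    obtain ⟨h1, h2⟩ := hcon
    have hx : A m (fun j => K (.inl j)) x = y := by_contra fun h => h1 (hAE _ _ _ h)
    refine hne ((cascade_eq hz fun hrob => ?_).trans hx)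
    rw [hx]
    exact by_contra fun h => h2 (fun h' => hrob (hAR _ _ h')) (hB _ _ _ ⟨z, hz, h⟩)
  · intro c hc N hN hb ι _ _ _ _ x hx P _
    by_cases hP : P = 0
    · exact ⟨fun _ => Classical.arbitrary ι, by simp [hP]⟩
    obtain ⟨J₁, hJ₁⟩ := exists_resample_notMem hP x <|
      (hAC c hc _ (isProbabilityMeasure_empirical hP x)
        (robustlyRealizable_empirical hN hb hx P)).trans_lt (ENNReal.ofReal_lt_one.2 hδ)
    obtain ⟨hrob, herr⟩ := not_not.1 hJ₁
    set S : Fin m → X × Y := labelled c fun j => x (J₁ j) with hS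
    set r : Set ι := {i | (S, x i) ∈ R}
    have hrob' : β * P.real Set.univ ≤ P.real r :=
      le_real_preimage_of_le_empirical hP (s := {x | (S, x) ∈ R})
        (hR.preimage (f := fun x => (S, x)) (by fun_prop)) hβ hrob
    have herr' : P.real {i | (S, (x i, c (x i))) ∈ E} ≤ ε * P.real Set.univ :=
      real_preimage_le_of_empirical_le hP (s := {x | (S, (x, c x)) ∈ E}) hε herr
    obtain ⟨J₂, hJ₂⟩ := hBC c hc N hN hb ι x hx (P.restrict rᶜ)
    refine ⟨Sum.elim J₁ J₂, ?_⟩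
    set l : Set ι := {i | ((fun j => (x (J₂ j), c (x (J₂ j)))), (x i, c (x i))) ∈ L}
    have hr : P.real rᶜ = P.real Set.univ - P.real r := measureReal_compl (.of_discrete)
    have hl : P.real (l ∩ rᶜ) ≤ θ * (P.real Set.univ - P.real r) := by
      rw [← hr]
      simpa [measureReal_restrict_apply (MeasurableSet.of_discrete (s := l))] using hJ₂
    calc P.real _ ≤ P.real ({i | (S, (x i, c (x i))) ∈ E} ∪ (l ∩ rᶜ)) := by
          refine measureReal_mono ?_
          rintro i (hi | ⟨hi, hi'⟩)
          · exact .inl hi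
          · exact .inr ⟨hi', hi⟩
      _ ≤ ε * P.real Set.univ + θ * (P.real Set.univ - P.real r) :=
          (measureReal_union_le _ _).trans (add_le_add herr' hl)
      _ ≤ ε * P.real Set.univ + θ * (P.real Set.univ - β * P.real Set.univ) := by gcongr
      _ = _ := by ring

/-- Iterating the cascade drives the loss level to the fixed point `ε₁` of `θ ↦ β ε₁ + (1 - β) θ`,
so below any level `θ` larger than `ε₁`. -/
theorem BarelyRobustlyLearnable.weakCompression [Nonempty Y] {β ε₁ δ θ : ℝ} (hβ : 0 < β)
    (hβ1 : β ≤ 1) (hε : 0 ≤ ε₁) (hε1 : ε₁ ≤ 1) (hδ : δ < 1) (hθ : ε₁ < θ)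
    (h : BarelyRobustlyLearnable U β (β * ε₁) δ C) : WeakCompression U θ C := by
  have key : ∀ T : ℕ, WeakCompression U (ε₁ + (1 - ε₁) * (1 - β) ^ T) C := by
    intro T
    induction T with
    | zero => simpa using weakCompression_one
    | succ T ih =>
      have h0 : 0 ≤ (1 - ε₁) * (1 - β) ^ T := mul_nonneg (by linarith) (pow_nonneg (by linarith) _)
      refine (ih.cascade hβ.le (by positivity) hδ (by linarith) h).mono (le_of_eq ?_)
      ring
  obtain ⟨T, hT⟩ := exists_pow_lt_of_lt_one (sub_pos.2 hθ) (show 1 - β < 1 by linarith)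
  refine (key T).mono ?_
  have : (1 - ε₁) * (1 - β) ^ T ≤ 1 * (1 - β) ^ T :=
    mul_le_mul_of_nonneg_right (by linarith) (pow_nonneg (by linarith) _)
  linarith

end Weak

/-! ### Boosting by majority votes -/

section Boosting

/-- Multiplicative weights: after `T` rounds, in each of which the weight of a point is multiplied
by `1 + a` if the chosen `h` errs on it, the total weight is at most `(1 + a θ) ^ T` times the
initial one. -/
theorem exists_sum_prod_le {ι H : Type*} [Fintype ι] {loss : H → Set ι} {θ a : ℝ} (ha : 0 ≤ a)
    (hθ : 0 ≤ θ)
    (hweak : ∀ w : ι → ℝ, (∀ i, 0 ≤ w i) → ∃ h, ∑ i, (loss h).indicator w i ≤ θ * ∑ i, w i)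
    (T : ℕ) :
    ∃ h : Fin T → H, ∑ i, ∏ t, (1 + (loss (h t)).indicator (fun _ => a) i) ≤
      Fintype.card ι * (1 + a * θ) ^ T := by
  induction T with
  | zero => exact ⟨Fin.elim0, by simp⟩
  | succ T ih =>
    obtain ⟨h, hh⟩ := ih
    set w : ι → ℝ := fun i => ∏ t, (1 + (loss (h t)).indicator (fun _ => a) i) with hw
    obtain ⟨h₀, h₀h⟩ := hweak w fun i => Finset.prod_nonneg fun t _ =>
      add_nonneg zero_le_one (Set.indicator_nonneg (fun _ _ => ha) _)
    refine ⟨Fin.cons h₀ h, ?_⟩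
    have hstep : ∀ i, ∏ t, (1 + (loss (Fin.cons (α := fun _ => H) h₀ h t)).indicator
        (fun _ => a) i) = w i + a * (loss h₀).indicator w i := by
      intro i
      rw [Fin.prod_univ_succ]
      simp only [Fin.cons_zero, Fin.cons_succ]
      by_cases hi : i ∈ loss h₀ <;> simp [hi, hw]
      ring
    simp only [hstep]
    rw [Finset.sum_add_distrib, ← Finset.mul_sum]
    calc ∑ i, w i + a * ∑ i, (loss h₀).indicator w i ≤ ∑ i, w i + a * (θ * ∑ i, w i) := by gcongr
      _ = (1 + a * θ) * ∑ i, w i := by ring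
      _ ≤ (1 + a * θ) * (Fintype.card ι * (1 + a * θ) ^ T) := by gcongr
      _ = _ := by ring

/-- The factor per round by which, for weak loss level `θ`, the weight of a point lost in at least
half of the rounds outgrows the total weight (both squared), with the update parameter
`a = 1 - 2 θ`. -/
noncomputable def boostRate (θ : ℝ) : ℝ := (1 + (1 - 2 * θ)) / (1 + (1 - 2 * θ) * θ) ^ 2

theorem one_lt_boostRate {θ : ℝ} (hθ : 0 ≤ θ) (hθ2 : θ < 1 / 2) : 1 < boostRate θ := by
  have h1 : 0 < 1 + (1 - 2 * θ) * θ := by nlinarith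
  rw [boostRate, one_lt_div (by positivity)]
  have h2 : 0 < (1 - 2 * θ) * ((1 - 2 * θ) * (1 - θ ^ 2) + 2 * θ * (1 - θ)) := by
    have h3 : 0 < 1 - 2 * θ := by linarith
    have h4 : 0 < 1 - θ ^ 2 := by nlinarith
    have h5 : 0 < 1 - θ := by linarith
    positivity
  nlinarith

open Classical in
/-- If every weighting of the points is served by some `h` of weighted loss at most `θ < 1 / 2`,
then logarithmically many of the `h` together lose every point less than half of the time. -/
theorem exists_majority {ι H : Type*} [Fintype ι] {loss : H → Set ι} {θ : ℝ}
    (hθ : 0 ≤ θ) (hθ2 : θ < 1 / 2)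
    (hweak : ∀ w : ι → ℝ, (∀ i, 0 ≤ w i) → ∃ h, ∑ i, (loss h).indicator w i ≤ θ * ∑ i, w i)
    {T : ℕ} (hT : (Fintype.card ι : ℝ) ^ 2 < boostRate θ ^ T) :
    ∃ h : Fin T → H, ∀ i, 2 * (Finset.univ.filter fun t => i ∈ loss (h t)).card < T := by
  have ha : 0 ≤ 1 - 2 * θ := by linarith
  obtain ⟨h, hh⟩ := exists_sum_prod_le ha hθ hweak T
  refine ⟨h, fun i => ?_⟩
  by_contra! hcon
  set k := (Finset.univ.filter fun t => i ∈ loss (h t)).card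
  set a := 1 - 2 * θ with haθ
  have hprod : ∏ t, (1 + (loss (h t)).indicator (fun _ => a) i) = (1 + a) ^ k := by
    rw [← Finset.prod_const, Finset.prod_filter]
    refine Finset.prod_congr rfl fun t _ => ?_
    by_cases hi : i ∈ loss (h t) <;> simp [hi]
  have hle : (1 + a) ^ k ≤ Fintype.card ι * (1 + a * θ) ^ T := by
    rw [← hprod]
    refine le_trans ?_ hh
    exact Finset.single_le_sum (f := fun i => ∏ t, (1 + (loss (h t)).indicator (fun _ => a) i))
      (fun j _ => Finset.prod_nonneg fun t _ =>
        add_nonneg zero_le_one (Set.indicator_nonneg (fun _ _ => ha) _)) (Finset.mem_univ i)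
  have hpos : 0 < 1 + a * θ := by positivity
  refine hT.not_ge ?_
  rw [boostRate, ← haθ, div_pow, div_le_iff₀ (by positivity)]
  calc (1 + a) ^ T ≤ (1 + a) ^ (2 * k) := pow_le_pow_right₀ (by linarith) hcon
    _ = ((1 + a) ^ k) ^ 2 := by ring
    _ ≤ (Fintype.card ι * (1 + a * θ) ^ T) ^ 2 := by gcongr
    _ = _ := by rw [mul_pow, ← pow_mul, ← pow_mul, mul_comm T 2]

/-- Weights on a finite index set, as a measure. -/
theorem exists_measure_real_eq {ι : Type*} [Fintype ι] [MeasurableSpace ι]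
    [DiscreteMeasurableSpace ι] {w : ι → ℝ} (hw : ∀ i, 0 ≤ w i) :
    ∃ P : Measure ι, IsFiniteMeasure P ∧ ∀ s, P.real s = ∑ i, s.indicator w i := by
  refine ⟨∑ i, ENNReal.ofReal (w i) • Measure.dirac i, ⟨?_⟩, fun s => ?_⟩
  · simp [ENNReal.sum_lt_top]
  · classical
    rw [measureReal_def, Measure.finsetSum_apply, ENNReal.toReal_sum]
    · refine Finset.sum_congr rfl fun i _ => ?_
      by_cases hi : i ∈ s <;>
        simp [Measure.dirac_apply' i (MeasurableSet.of_discrete (s := s)), hi, hw i]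
    · intro i _
      simp only [Measure.smul_apply, smul_eq_mul]
      exact ENNReal.mul_ne_top ENNReal.ofReal_ne_top (measure_ne_top _ _)

open Classical in
/-- The label that more than half of the votes `v` give, if there is one. -/
noncomputable def majority {Y : Type*} [Nonempty Y] {T : ℕ} (v : Fin T → Y) : Y :=
  if H : ∃ y, 2 * (Finset.univ.filter fun t => v t ≠ y).card < T then H.choose
  else Classical.arbitrary Y

open Classical in
theorem majority_eq {Y : Type*} [Nonempty Y] {T : ℕ} {v : Fin T → Y} {y : Y}
    (hy : 2 * (Finset.univ.filter fun t => v t ≠ y).card < T) : majority v = y := by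
  have H : ∃ y, 2 * (Finset.univ.filter fun t => v t ≠ y).card < T := ⟨y, hy⟩
  rw [majority, dif_pos H]
  by_contra hne
  have hspec := H.choose_spec
  set y' := H.choose
  have hcover : (Finset.univ : Finset (Fin T)) ⊆
      (Finset.univ.filter fun t => v t ≠ y') ∪ (Finset.univ.filter fun t => v t ≠ y) := by
    intro t _
    simp only [Finset.mem_union, Finset.mem_filter, Finset.mem_univ, true_and]
    by_contra! h
    exact hne (h.1.symm.trans h.2)
  have := (Finset.card_le_card hcover).trans (Finset.card_union_le _ _)
  rw [Finset.card_univ, Fintype.card_fin] at this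
  omega

/-- Boosting a weak robust compression by majority votes: `2 ^ n` robustly labelled points are
compressed, without any loss on them, to a number of points linear in `n`. -/
theorem WeakCompression.exists_consistent {X Y : Type*} [MeasurableSpace X] [MeasurableSpace Y]
    [Nonempty Y] {U : X → Set X} {C : Set (X → Y)} {θ : ℝ} (hθ : 0 ≤ θ) (hθ2 : θ < 1 / 2)
    (h : WeakCompression U θ C) :
    ∃ k : ℕ, ∀ n, 1 ≤ n → ∃ (κ : Type) (_ : Fintype κ) (A : (κ → X × Y) → X → Y)
      (L : Set ((κ → X × Y) × (X × Y))), Fintype.card κ = k * n ∧ UnivMeasurableSet L ∧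
      (∀ K x y, (∃ z ∈ U x, A K z ≠ y) → (K, (x, y)) ∈ L) ∧
      ∀ c ∈ C, ∀ N : Set X, MeasurableSet N → {x | ∃ z ∈ U x, c z ≠ c x} ⊆ N →
        ∀ x : Fin (2 ^ n) → X, (∀ i, x i ∉ N) → ∃ J : κ → Fin (2 ^ n),
          ∀ i, ((fun j => (x (J j), c (x (J j)))), (x i, c (x i))) ∉ L := by
  classical
  obtain ⟨κ, _, A, L, hL, hA, hC⟩ := h
  obtain ⟨r, hr⟩ := pow_unbounded_of_one_lt 4 (one_lt_boostRate hθ hθ2)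
  refine ⟨Fintype.card κ * r, fun n hn => ⟨κ × Fin (r * n), inferInstance,
    fun K z => majority fun t => A (fun j => K (j, t)) z,
    {p | r * n ≤ 2 * (Finset.univ.filter fun t =>
      ((fun j => p.1 (j, t)), p.2) ∈ L).card}, ?_, ?_, ?_, ?_⟩⟩
  · simp [mul_assoc]
  · have hm : ∀ t : Fin (r * n), UnivMeasurableSet
        {p : ((κ × Fin (r * n) → X × Y) × (X × Y)) | ((fun j => p.1 (j, t)), p.2) ∈ L} :=
      fun t => hL.preimage (f := fun p : ((κ × Fin (r * n) → X × Y) × (X × Y)) =>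
        ((fun j => p.1 (j, t)), p.2)) (by fun_prop)
    exact .boolean hm fun F => r * n ≤ 2 * (Finset.univ.filter fun t => t ∈ F).card
  · rintro K x y ⟨z, hz, hne⟩
    by_contra hcon
    rw [Set.mem_ofPred_eq, not_le] at hcon
    refine hne (majority_eq (lt_of_le_of_lt ?_ hcon))
    refine Nat.mul_le_mul_left 2 (Finset.card_le_card fun t ht => ?_)
    simp only [Finset.mem_filter, Finset.mem_univ, true_and] at ht ⊢
    exact hA _ _ _ ⟨z, hz, ht⟩
  · intro c hc N hN hb x hx
    have hweak : ∀ w : Fin (2 ^ n) → ℝ, (∀ i, 0 ≤ w i) → ∃ J : κ → Fin (2 ^ n),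
        ∑ i, Set.indicator {i | ((fun j => (x (J j), c (x (J j)))), (x i, c (x i))) ∈ L} w i ≤
          θ * ∑ i, w i := by
      intro w hw
      obtain ⟨P, hP, hPw⟩ := exists_measure_real_eq hw
      obtain ⟨J, hJ⟩ := hC c hc N hN hb (Fin (2 ^ n)) x hx P
      refine ⟨J, ?_⟩
      simpa [hPw] using hJ
    have hcard : (Fintype.card (Fin (2 ^ n)) : ℝ) ^ 2 < boostRate θ ^ (r * n) := by
      rw [pow_mul, Fintype.card_fin]
      calc ((2 ^ n : ℕ) : ℝ) ^ 2 = 4 ^ n := by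
            push_cast
            rw [← pow_mul, mul_comm, pow_mul]
            norm_num
        _ < _ := pow_lt_pow_left₀ hr (by norm_num) (by omega)
    obtain ⟨J, hJ⟩ := exists_majority hθ hθ2 hweak hcard
    refine ⟨fun p => J p.2 p.1, fun i => ?_⟩
    rw [Set.mem_ofPred_eq, not_le]
    exact hJ i

end Boosting

/-! ### Generalization of compression schemes -/

section Generalization

/-- For a random `a`, the probability that the section of `Q` at `a` has probability more than `ε`
while an independent i.i.d. sample misses it entirely is at most `(1 - ε) ^ card ι`. -/
theorem prod_pi_miss_le {α X ι : Type*} [MeasurableSpace α] [MeasurableSpace X] [Fintype ι]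
    (μ : Measure α) [IsProbabilityMeasure μ] (D : Measure X) [IsProbabilityMeasure D]
    {Q : Set (α × X)} (hQ : UnivMeasurableSet Q) (ε : ENNReal) :
    μ.prod (Measure.pi fun _ : ι => D)
      {p | (∀ i, (p.1, p.2 i) ∉ Q) ∧ ε < D {x | (p.1, x) ∈ Q}} ≤ (1 - ε) ^ Fintype.card ι := by
  obtain ⟨G, hGQ, hG, hae⟩ := (hQ (μ.prod D) inferInstance).exists_measurable_subset_ae_eq
  -- For almost every `a`, the sections of `Q` and of its measurable kernel `G` have equal measure.
  have hsec : ∀ᵐ a ∂μ, D {x | (a, x) ∈ G} = D {x | (a, x) ∈ Q} := by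
    filter_upwards [Measure.ae_ae_of_ae_prod hae] with a ha
    exact measure_congr ha
  set B : Set (α × (ι → X)) := {p | (∀ i, (p.1, p.2 i) ∉ G) ∧ ε < D {x | (p.1, x) ∈ G}}
  have hB : MeasurableSet B := by
    refine MeasurableSet.inter (s₁ := {p : α × (ι → X) | ∀ i, (p.1, p.2 i) ∉ G})
      (s₂ := {p : α × (ι → X) | ε < D {x | (p.1, x) ∈ G}}) ?_ ?_
    · have : {p : α × (ι → X) | ∀ i, (p.1, p.2 i) ∉ G} =
          ⋂ i, (fun p : α × (ι → X) => (p.1, p.2 i)) ⁻¹' Gᶜ := by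
        ext p
        simp
      rw [this]
      exact .iInter fun i => hG.compl.preimage (by fun_prop)
    · exact measurableSet_lt measurable_const ((measurable_measure_prodMk_left hG).comp
        measurable_fst)
  have hle : μ.prod (Measure.pi fun _ : ι => D)
      {p | (∀ i, (p.1, p.2 i) ∉ Q) ∧ ε < D {x | (p.1, x) ∈ Q}} ≤
      μ.prod (Measure.pi fun _ : ι => D) B := by
    refine measure_mono_ae ?_
    filter_upwards [Measure.quasiMeasurePreserving_fst.ae hsec] with p hp h
    exact ⟨fun i hi => h.1 i (hGQ hi), hp ▸ h.2⟩
  refine hle.trans ?_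
  rw [Measure.prod_apply hB]
  calc ∫⁻ a, Measure.pi (fun _ : ι => D) (Prod.mk a ⁻¹' B) ∂μ
      ≤ ∫⁻ _, (1 - ε) ^ Fintype.card ι ∂μ := by
        refine lintegral_mono fun a => ?_
        have hGa : MeasurableSet {x | (a, x) ∈ G} := hG.preimage measurable_prodMk_left
        by_cases ha : ε < D {x | (a, x) ∈ G}
        · calc Measure.pi (fun _ : ι => D) (Prod.mk a ⁻¹' B)
              ≤ Measure.pi (fun _ : ι => D) (Set.univ.pi fun _ => {x | (a, x) ∈ G}ᶜ) :=
                measure_mono fun τ hτ i _ => hτ.1 i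
            _ = (1 - D {x | (a, x) ∈ G}) ^ Fintype.card ι := by
                rw [Measure.pi_pi, Finset.prod_const, Finset.card_univ,
                  prob_compl_eq_one_sub hGa]
            _ ≤ _ := by gcongr
        · have : Prod.mk a ⁻¹' B = ∅ := Set.eq_empty_of_forall_notMem fun τ hτ => ha hτ.2
          simp [this]
    _ = _ := by simp

/-- A sample compressed to a given tuple `J` of its indices generalizes: the points outside the
compressed tuple are an independent test sample. -/
theorem pi_miss_le {X ι κ : Type*} [MeasurableSpace X] [Fintype ι] [Fintype κ] (J : κ → ι)
    (D : Measure X) [IsProbabilityMeasure D] {Q : Set ((κ → X) × X)} (hQ : UnivMeasurableSet Q)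
    (ε : ENNReal) :
    Measure.pi (fun _ : ι => D)
      {S | (∀ i, ((fun j => S (J j)), S i) ∉ Q) ∧ ε < D {x | ((fun j => S (J j)), x) ∈ Q}} ≤
      (1 - ε) ^ (Fintype.card ι - Fintype.card κ) := by
  classical
  let p : ι → Prop := fun i => i ∈ Set.range J
  let e := MeasurableEquiv.piEquivPiSubtypeProd (fun _ : ι => X) p
  let Q' : Set (({i // p i} → X) × X) :=
    (fun q => ((fun j => q.1 ⟨J j, Set.mem_range_self j⟩), q.2)) ⁻¹' Q
  have hQ' : UnivMeasurableSet Q' := hQ.preimage (by fun_prop)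
  have he : MeasurePreserving e (Measure.pi fun _ : ι => D) _ :=
    measurePreserving_piEquivPiSubtypeProd (fun _ : ι => D) p
  have hcard : Fintype.card ι - Fintype.card κ ≤ Fintype.card {i // ¬ p i} := by
    have h1 := Fintype.card_subtype_compl p
    have h2 : Fintype.card {i // p i} ≤ Fintype.card κ :=
      Fintype.card_le_of_surjective (fun j => ⟨J j, Set.mem_range_self j⟩)
        fun ⟨_, j, hj⟩ => ⟨j, Subtype.ext hj⟩
    omega
  calc _ ≤ Measure.pi (fun _ : ι => D) (e ⁻¹' {q | (∀ i, (q.1, q.2 i) ∉ Q') ∧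
        ε < D {x | (q.1, x) ∈ Q'}}) :=
        measure_mono fun S hS => ⟨fun i => hS.1 i, hS.2⟩
    _ = _ := he.measure_preimage_equiv _
    _ ≤ (1 - ε) ^ Fintype.card {i // ¬ p i} := prod_pi_miss_le _ D hQ' ε
    _ ≤ _ := pow_le_pow_right_of_le_one' tsub_le_self hcard

/-- The failure probability of a compression scheme tends to zero when `2 ^ n` points are compressed
to linearly many in `n`. -/
theorem exists_compression_bound_le (k n₀ : ℕ) {q δ : ℝ} (hq : 0 ≤ q) (hq1 : q < 1) (hδ : 0 < δ) :
    ∃ n, 1 ≤ n ∧ n₀ ≤ 2 ^ n ∧ ((2 ^ n : ℕ) : ℝ) ^ (k * n) * q ^ (2 ^ n - k * n) ≤ δ := by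
  obtain ⟨s, hs⟩ := exists_pow_lt_of_lt_one (show (0 : ℝ) < 1 / 2 by norm_num) hq1
  obtain ⟨r, hr⟩ := exists_pow_lt_of_lt_one hδ (show (1 / 2 : ℝ) < 1 by norm_num)
  set b := k + s * (k + r) + 1 with hb
  have hlim := tendsto_pow_const_div_const_pow_of_one_lt 2 (show (1 : ℝ) < 2 by norm_num)
  have hev := hlim.eventually (gt_mem_nhds (show (0 : ℝ) < 1 / b by positivity))
  obtain ⟨n, hn, hn1, hn0⟩ :=
    (hev.and ((Filter.eventually_ge_atTop 1).and (Filter.eventually_ge_atTop n₀))).exists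
  refine ⟨n, hn1, hn0.trans Nat.lt_two_pow_self.le, ?_⟩
  have hbn : b * n ^ 2 ≤ 2 ^ n := by
    rw [div_lt_div_iff₀ (by positivity) (by positivity), one_mul] at hn
    have : ((n ^ 2 * b : ℕ) : ℝ) < ((2 ^ n : ℕ) : ℝ) := by exact_mod_cast hn
    have := Nat.cast_lt.1 this
    linarith
  -- The exponent of `q` pays for the number `2 ^ (k n ^ 2)` of tuples and for `δ`.
  have hexp : s * (k * n * n + r) ≤ 2 ^ n - k * n := by
    have h1 : n ≤ n ^ 2 := by nlinarith
    have h2 : 1 ≤ n ^ 2 := by nlinarith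
    have h3 : k * n ≤ k * n ^ 2 := Nat.mul_le_mul_left _ h1
    have h4 : s * r * 1 ≤ s * r * n ^ 2 := Nat.mul_le_mul_left _ h2
    have h5 : s * (k * n * n + r) + k * n ≤ 2 ^ n := by
      refine le_trans ?_ hbn
      rw [hb]
      nlinarith
    omega
  have hqs : q ^ (2 ^ n - k * n) ≤ (1 / 2) ^ (k * n * n + r) := by
    calc q ^ (2 ^ n - k * n) ≤ q ^ (s * (k * n * n + r)) :=
          pow_le_pow_of_le_one hq hq1.le hexp
      _ = (q ^ s) ^ (k * n * n + r) := pow_mul _ _ _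
      _ ≤ _ := by gcongr
  calc ((2 ^ n : ℕ) : ℝ) ^ (k * n) * q ^ (2 ^ n - k * n)
      ≤ ((2 ^ n : ℕ) : ℝ) ^ (k * n) * (1 / 2) ^ (k * n * n + r) := by gcongr
    _ = (1 / 2) ^ r := by
        push_cast
        rw [pow_add, ← mul_assoc, ← pow_mul, show n * (k * n) = k * n * n by ring, ← mul_pow]
        norm_num
    _ ≤ δ := hr.le

variable {X Y : Type*} [MeasurableSpace X] [MeasurableSpace Y] {U : X → Set X} {C : Set (X → Y)}

/-- The index tuples of a sample at which the compression loss `L` misses the whole sample. -/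
def consistentTuples {Z κ : Type*} (L : Set ((κ → Z) × Z)) {m : ℕ} (S : Fin m → Z) :
    Set (κ → Fin m) :=
  {J | ∀ i, ((fun j => S (J j)), S i) ∉ L}

open Classical in
/-- The learner of a compression scheme: it reconstructs a predictor from some consistent tuple of
its sample.  The chosen tuple depends on the sample only through the finite set of all consistent
tuples, which keeps its loss event universally measurable. -/
noncomputable def compressionLearner {X Y : Type*} [Nonempty Y] {κ : Type}
    (A : (κ → X × Y) → X → Y) (L : Set ((κ → X × Y) × (X × Y))) : Learner X Y :=
  fun _ S => if h : (consistentTuples L S).Nonempty then A (fun j => S (h.some j))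
    else fun _ => Classical.arbitrary Y

/-- Boosting, with the sample size as large as desired. -/
theorem WeakCompression.robustlyLearnable [Nonempty Y] {θ : ℝ} (hθ : 0 ≤ θ) (hθ2 : θ < 1 / 2)
    (hC : ∀ c ∈ C, Measurable c) (h : WeakCompression U θ C) {ε δ : ℝ} (hε : 0 < ε) (hε1 : ε < 1)
    (hδ : 0 < δ) (n₀ : ℕ) :
    ∃ (A : Learner X Y) (m : ℕ) (L : Set ((Fin m → X × Y) × (X × Y))), n₀ ≤ m ∧
      UnivMeasurableSet L ∧ (∀ S x y, (∃ z ∈ U x, A m S z ≠ y) → (S, (x, y)) ∈ L) ∧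
      ∀ c ∈ C, ∀ D : Measure X, IsProbabilityMeasure D → RobustlyRealizable U c D →
        Measure.pi (fun _ : Fin m => D)
          {S | ¬ D {x | (labelled c S, (x, c x)) ∈ L} ≤ ENNReal.ofReal ε} ≤ ENNReal.ofReal δ := by
  classical
  obtain ⟨k, hk⟩ := h.exists_consistent hθ hθ2
  obtain ⟨n, hn, hn0, hbound⟩ := exists_compression_bound_le k n₀
    (show 0 ≤ 1 - ε by linarith) (show 1 - ε < 1 by linarith) hδ
  obtain ⟨κ, _, A, L, hcard, hL, hA, hcons⟩ := hk n hn
  set m := 2 ^ n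
  refine ⟨compressionLearner A L, m, {p | ∀ h : (consistentTuples L p.1).Nonempty,
    ((fun j => p.1 (h.some j)), p.2) ∈ L}, hn0, ?_, ?_, ?_⟩
  · let s : ((κ → Fin m) ⊕ (κ → Fin m)) → Set ((Fin m → X × Y) × (X × Y)) :=
      Sum.elim (fun J => {p | J ∈ consistentTuples L p.1})
        (fun J => {p | ((fun j => p.1 (J j)), p.2) ∈ L})
    have hs : ∀ i, UnivMeasurableSet (s i) := by
      rintro (J | J)
      · have : s (.inl J) = ⋂ i, ((fun p : (Fin m → X × Y) × (X × Y) =>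
            ((fun j => p.1 (J j)), p.1 i)) ⁻¹' L)ᶜ := by
          ext p
          simp [s, consistentTuples]
        rw [this]
        exact .iInter fun i => (hL.preimage (by fun_prop)).compl
      · exact hL.preimage (f := fun p : (Fin m → X × Y) × (X × Y) =>
          ((fun j => p.1 (J j)), p.2)) (by fun_prop)
    exact .boolean hs fun F => ∀ h : {J | Sum.inl J ∈ F}.Nonempty, Sum.inr h.some ∈ F
  · rintro S x y ⟨z, hz, hne⟩ h
    refine hA _ _ _ ⟨z, hz, ?_⟩
    rwa [compressionLearner, dif_pos h] at hne
  · intro c hc D _ hD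
    set N := toMeasurable D {x | ∃ z ∈ U x, c z ≠ c x}
    have hcm := hC c hc
    let Q : Set ((κ → X) × X) :=
      (fun q => ((fun j => (q.1 j, c (q.1 j))), (q.2, c q.2))) ⁻¹' L
    have hQ : UnivMeasurableSet Q := hL.preimage (by fun_prop)
    have hNnull : ∀ i, Measure.pi (fun _ : Fin m => D) {S | S i ∈ N} = 0 := by
      intro i
      have := (measurePreserving_eval (fun _ : Fin m => D) i).measure_preimage
        (measurableSet_toMeasurable D {x | ∃ z ∈ U x, c z ≠ c x}).nullMeasurableSet
      rw [measure_toMeasurable] at this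
      exact this.trans hD
    have hsub : {S : Fin m → X | ¬ D {x | (labelled c S, (x, c x)) ∈
          {p : (Fin m → X × Y) × (X × Y) | ∀ h : (consistentTuples L p.1).Nonempty,
            ((fun j => p.1 (h.some j)), p.2) ∈ L}} ≤ ENNReal.ofReal ε} ⊆
        (⋃ i, {S | S i ∈ N}) ∪ ⋃ J : κ → Fin m,
          {S | (∀ i, ((fun j => S (J j)), S i) ∉ Q) ∧
            ENNReal.ofReal ε < D {x | ((fun j => S (J j)), x) ∈ Q}} := by
      intro S hS
      by_cases hSN : ∃ i, S i ∈ N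
      · exact .inl (Set.mem_iUnion.2 hSN)
      · push Not at hSN
        have hne : (consistentTuples L (labelled c S)).Nonempty :=
          hcons c hc N (measurableSet_toMeasurable _ _) (subset_toMeasurable _ _) S hSN
        refine .inr (Set.mem_iUnion.2 ⟨hne.some, hne.some_mem, ?_⟩)
        refine (not_le.1 hS).trans_le (measure_mono fun x hx => ?_)
        exact hx hne
    refine (measure_mono hsub).trans ((measure_union_le _ _).trans ?_)
    rw [measure_iUnion_null hNnull, zero_add]
    refine (measure_iUnion_fintype_le _ _).trans ?_
    refine (Finset.sum_le_sum fun J _ => pi_miss_le J D hQ (ENNReal.ofReal ε)).trans ?_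
    rw [Finset.sum_const, Finset.card_univ, Fintype.card_fun, Fintype.card_fin, hcard,
      nsmul_eq_mul]
    refine le_trans (le_of_eq ?_) (ENNReal.ofReal_le_ofReal hbound)
    have h1 : (1 : ENNReal) - ENNReal.ofReal ε = ENNReal.ofReal (1 - ε) := by
      rw [ENNReal.ofReal_sub _ hε.le, ENNReal.ofReal_one]
    rw [h1, ENNReal.ofReal_mul (by positivity), ENNReal.ofReal_pow (by linarith),
      ENNReal.ofReal_pow (by positivity), ENNReal.ofReal_natCast]
    push_cast
    rfl

end Generalization

/-! ### From robust to barely robust learning -/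

section MajorityLabel

open Classical in
/-- Chebyshev's inequality for frequencies: an event of probability at most `1 / 2 - η` is unlikely
to occur in at least half of a large i.i.d. sample. -/
theorem pi_half_le_card_le {X : Type*} [MeasurableSpace X] (D : Measure X)
    [IsProbabilityMeasure D] {s : Set X} (hs : MeasurableSet s) {η : ℝ} (hη : 0 < η)
    (hDs : D.real s ≤ 1 / 2 - η) {m : ℕ} (hm : 0 < m) :
    Measure.pi (fun _ : Fin m => D)
      {S | m ≤ 2 * (Finset.univ.filter fun i => S i ∈ s).card} ≤
      ENNReal.ofReal (1 / (4 * m * η ^ 2)) := by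
  set μ := Measure.pi (fun _ : Fin m => D)
  set f : X → ℝ := s.indicator fun _ => 1
  have hfm : Measurable f := measurable_const.indicator hs
  have hf01 : ∀ x, f x ∈ Set.Icc (0 : ℝ) 1 := fun x => by
    by_cases hx : x ∈ s <;> simp [f, hx]
  have hfL : MemLp f 2 D := memLp_of_bounded (.of_forall hf01) hfm.aestronglyMeasurable 2
  set Z : (Fin m → X) → ℝ := ∑ i, fun S => f (S i)
  have hZL : MemLp Z 2 μ := memLp_finsetSum' _ fun i _ =>
    hfL.comp_measurePreserving (measurePreserving_eval _ i)
  have hmean : ∫ S, Z S ∂μ = m * D.real s := by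
    simp only [Z, Finset.sum_apply]
    rw [integral_finsetSum]
    · simp only [μ, integral_comp_eval (μ := fun _ : Fin m => D) hfm.aestronglyMeasurable]
      simp [f, integral_indicator hs]
    · exact fun i _ => (hfL.comp_measurePreserving
        (measurePreserving_eval (fun _ : Fin m => D) i)).integrable (by norm_num)
  have hvar : ProbabilityTheory.variance Z μ ≤ m / 4 := by
    have h1 := ProbabilityTheory.variance_sum_pi (μ := fun _ : Fin m => D) (X := fun _ => f)
      fun _ => hfL
    have h2 := ProbabilityTheory.variance_le_sq_of_bounded (μ := D) (.of_forall hf01)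
      hfm.aemeasurable
    have h3 : ProbabilityTheory.variance Z μ = ∑ _i : Fin m, ProbabilityTheory.variance f D := h1
    rw [h3, Finset.sum_const, Finset.card_univ, Fintype.card_fin, nsmul_eq_mul]
    have : (m : ℝ) * ProbabilityTheory.variance f D ≤ m * ((1 - 0) / 2) ^ 2 := by gcongr
    linarith
  have hmpos : (0 : ℝ) < m := by exact_mod_cast hm
  have hcheb := ProbabilityTheory.meas_ge_le_variance_div_sq hZL
    (show 0 < m * η by positivity)
  refine (measure_mono fun S hS => ?_).trans (hcheb.trans (ENNReal.ofReal_le_ofReal ?_))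
  · have hZ : Z S = (Finset.univ.filter fun i => S i ∈ s).card := by
      simp [Z, f, Set.indicator_apply]
    have hS' : (m : ℝ) ≤ 2 * Z S := by
      rw [hZ]
      exact_mod_cast hS
    rw [Set.mem_ofPred_eq, hmean]
    refine le_trans ?_ (le_abs_self _)
    have : (m : ℝ) * D.real s ≤ m * (1 / 2 - η) := by gcongr
    linarith
  · calc ProbabilityTheory.variance Z μ / (m * η) ^ 2 ≤ (m / 4) / (m * η) ^ 2 := by gcongr
      _ = _ := by field_simp

open Classical in
/-- The more frequent of the labels `y₀` and `y₁` in a sample that has no other labels. -/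
noncomputable def sampleLabel {X Y : Type*} (y₀ y₁ : Y) {m : ℕ} (S : Fin m → X × Y) : Y :=
  if m ≤ 2 * (Finset.univ.filter fun i => (S i).2 = y₀).card then y₀ else y₁

theorem measurable_sampleLabel {X Y : Type*} [MeasurableSpace X] [MeasurableSpace Y]
    [MeasurableSingletonClass Y] (y₀ y₁ : Y) (m : ℕ) :
    Measurable (sampleLabel (X := X) y₀ y₁ (m := m)) := by
  classical
  refine Measurable.ite ?_ measurable_const measurable_const
  have : Measurable fun S : Fin m → X × Y =>
      (Finset.univ.filter fun i => (S i).2 = y₀).card := by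
    simp only [Finset.card_filter]
    refine Finset.measurable_sum _ fun i _ => Measurable.ite ?_ measurable_const measurable_const
    exact (measurableSet_singleton y₀).preimage
      (f := fun S : Fin m → X × Y => (S i).2) (by fun_prop)
  exact measurableSet_le measurable_const (this.const_mul 2)

open Classical in
/-- The predictor that spreads the label `y` of `h` along `U`: it predicts `y` wherever `h` does so
at some perturbation, and the other label elsewhere. -/
noncomputable def spread {X Y : Type*} (U : X → Set X) (h : X → Y) (y y' : Y) (x : X) : Y :=
  if ∃ z ∈ U x, h z = y then y else y'

/-- Where `h` robustly predicts `y`, spreading `y` is robust with respect to `U⁻¹(U)`, since every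
point sharing a perturbation with `x` sees the label `y` there. -/
theorem mem_rob_spread {X Y : Type*} {U : X → Set X} (hU : ∀ x, (U x).Nonempty) {h : X → Y}
    {y y' : Y} {x : X} (hx : ∀ z ∈ U x, h z = y) : x ∈ Rob (sharedPert U) (spread U h y y') := by
  have key : ∀ x', (∃ z, z ∈ U x ∧ z ∈ U x') → spread U h y y' x' = y := by
    rintro x' ⟨z, hz, hz'⟩
    exact if_pos ⟨z, hz', hx z hz⟩
  obtain ⟨z, hz⟩ := hU x
  intro x' hx'
  rw [key x' hx', key x ⟨z, hz, hz⟩]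

theorem spread_eq {X Y : Type*} {U : X → Set X} (hU : ∀ x, (U x).Nonempty) {h : X → Y}
    {y y' y'' : Y} {x : X} (hx : ∀ z ∈ U x, h z = y'') (hy : y'' = y ∨ y'' = y') :
    spread U h y y' x = y'' := by
  obtain ⟨z, hz⟩ := hU x
  unfold spread
  split_ifs with H
  · obtain ⟨w, hw, hwy⟩ := H
    exact hwy.symm.trans (hx w hw)
  · rcases hy with rfl | rfl
    · exact (H ⟨z, hz, hx z hz⟩).elim
    · rfl

end MajorityLabel

section Barely

variable {X Y : Type*} [MeasurableSpace X] [MeasurableSpace Y] {U : X → Set X} {C : Set (X → Y)}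

/-- A constant predictor is robust everywhere. -/
theorem barelyRobustlyLearnable_of_one_le_error [Nonempty Y] {β ε : ℝ} (hβ : β ≤ 1)
    (hε : 1 ≤ ε) (δ : ℝ) : BarelyRobustlyLearnable U β ε δ C := by
  refine ⟨fun _ _ _ => Classical.arbitrary Y, 0, Set.univ, Set.univ,
    MeasurableSet.univ.univMeasurableSet, MeasurableSet.univ.univMeasurableSet,
    fun _ _ _ _ _ => rfl, fun _ _ _ _ => trivial, fun c _ D _ _ => ?_⟩
  refine le_trans (measure_mono_null (t := ∅) ?_ measure_empty).le zero_le
  intro S hS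
  refine absurd ?_ hS
  simp [hβ, hε]

/-- Spreading the majority label of a predictor with small robust loss. -/
theorem WeakCompression.barelyRobustlyLearnable [MeasurableSingletonClass Y]
    (hY : Nat.card Y = 2) (hU : ∀ x, (U x).Nonempty) (hC : ∀ c ∈ C, Measurable c) {θ : ℝ}
    (hθ : 0 ≤ θ) (hθ2 : θ < 1 / 2) (h : WeakCompression U θ C) {ε δ : ℝ} (hε : 0 < ε)
    (hε1 : ε < 1) (hδ : 0 < δ) :
    BarelyRobustlyLearnable U ((1 - ε) / 2) (2 * ε) (2 * δ) C := by
  classical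
  obtain ⟨y₀, y₁, hne, huniv⟩ := Nat.card_eq_two_iff.1 hY
  have hcase : ∀ y : Y, y = y₀ ∨ y = y₁ := fun y => by
    have : y ∈ ({y₀, y₁} : Set Y) := huniv ▸ Set.mem_univ y
    simpa using this
  have : Nonempty Y := ⟨y₀⟩
  set η := ε / 4 with hη
  have hηpos : 0 < η := by positivity
  obtain ⟨n₀, hn₀⟩ := exists_nat_gt (1 / (4 * η ^ 2) / (δ / 2))
  obtain ⟨A, m, L, hm, hL, hA, hAC⟩ := h.robustlyLearnable hθ hθ2 hC hηpos
    (by linarith) hδ (n₀ + 1)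
  have hm0 : 0 < m := by omega
  set lab : (Fin m → X × Y) → Y := sampleLabel y₀ y₁ with hlab
  have hlabm : Measurable lab := measurable_sampleLabel y₀ y₁ m
  have hcheb : 1 / (4 * m * η ^ 2) ≤ δ / 2 := by
    have h1 : (n₀ : ℝ) ≤ m := by exact_mod_cast (by omega : n₀ ≤ m)
    have h2 := hn₀.trans_le h1
    rw [div_lt_iff₀ (by positivity), div_lt_iff₀ (by positivity)] at h2
    rw [div_le_iff₀ (by positivity)]
    linarith
  let B : Learner X Y := fun n S =>
    spread U (A n S) (sampleLabel y₀ y₁ S) (if sampleLabel y₀ y₁ S = y₀ then y₁ else y₀)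
  refine ⟨B, m, {p | (p.1, (p.2, lab p.1)) ∉ L}, L, ?_, hL, ?_, ?_, ?_⟩
  · exact (hL.preimage (f := fun p : (Fin m → X × Y) × X => (p.1, (p.2, lab p.1)))
      (by fun_prop)).compl
  · intro S x hx
    refine mem_rob_spread hU fun z hz => ?_
    exact by_contra fun h => hx (hA _ _ _ ⟨z, hz, h⟩)
  · intro S x y hy
    by_contra hx
    refine hy (spread_eq hU (fun z hz => by_contra fun h => hx (hA _ _ _ ⟨z, hz, h⟩)) ?_)
    rcases hcase (sampleLabel y₀ y₁ S) with h | h <;> rcases hcase y with h' | h' <;>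
      simp [h, h', hne.symm]
  · intro c hc D _ hD
    have hcm := hC c hc
    have hmeas : ∀ y, MeasurableSet (c ⁻¹' {y}) := fun y => (measurableSet_singleton y).preimage hcm
    -- The samples in which a label with probability less than `1 / 2 - η` has frequency at least
    -- one half.
    let bad : Y → Set (Fin m → X) := fun y => {S | D.real (c ⁻¹' {y}) ≤ 1 / 2 - η ∧
      m ≤ 2 * (Finset.univ.filter fun i => S i ∈ c ⁻¹' {y}).card}
    have hbad : ∀ y, Measure.pi (fun _ : Fin m => D) (bad y) ≤ ENNReal.ofReal (δ / 2) := by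
      intro y
      by_cases hy : D.real (c ⁻¹' {y}) ≤ 1 / 2 - η
      · refine (measure_mono fun S hS => ?_).trans ((pi_half_le_card_le D (hmeas y) hηpos hy
          hm0).trans (ENNReal.ofReal_le_ofReal hcheb))
        exact hS.2
      · have : bad y = ∅ := Set.eq_empty_of_forall_notMem fun S hS => hy hS.1
        simp [this]
    have hsub : {S : Fin m → X | ¬ (ENNReal.ofReal ((1 - ε) / 2) ≤ D {x | (labelled c S, x) ∈
          {p : (Fin m → X × Y) × X | (p.1, (p.2, lab p.1)) ∉ L}} ∧
        D {x | (labelled c S, (x, c x)) ∈ L} ≤ ENNReal.ofReal (2 * ε))} ⊆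
        {S | ¬ D {x | (labelled c S, (x, c x)) ∈ L} ≤ ENNReal.ofReal η} ∪ (bad y₀ ∪ bad y₁) := by
      intro S hS
      by_contra hcon
      simp only [Set.mem_union, not_or] at hcon
      obtain ⟨h1, h2, h3⟩ := hcon
      have hloss := not_not.1 h1
      refine hS ⟨?_, hloss.trans (ENNReal.ofReal_le_ofReal (by linarith))⟩
      -- The label spread by the learner is nearly a majority label of `D`.
      have hfreq : 1 / 2 - η < D.real (c ⁻¹' {lab (labelled c S)}) := by
        by_contra! hle
        simp only [hlab, sampleLabel] at hle
        split_ifs at hle with hif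
        · exact h2 ⟨hle, hif⟩
        · refine h3 ⟨hle, ?_⟩
          have hcompl : (Finset.univ.filter fun i => ¬ (labelled c S i).2 = y₀) =
              Finset.univ.filter fun i => S i ∈ c ⁻¹' {y₁} := by
            refine Finset.filter_congr fun i _ => ?_
            rcases hcase (c (S i)) with h | h <;> simp [labelled, h, hne, hne.symm]
          have hsum := Finset.card_filter_add_card_filter_not (s := (Finset.univ : Finset (Fin m)))
            fun i => (labelled c S i).2 = y₀
          rw [hcompl, Finset.card_univ, Fintype.card_fin] at hsum
          omega
      have hcover : c ⁻¹' {lab (labelled c S)} ⊆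
          {x | (labelled c S, (x, lab (labelled c S))) ∉ L} ∪
            {x | (labelled c S, (x, c x)) ∈ L} := by
        intro x hx
        have hx' : c x = lab (labelled c S) := hx
        by_cases hxL : (labelled c S, (x, c x)) ∈ L
        · exact .inr hxL
        · exact .inl (by rwa [Set.mem_ofPred_eq, ← hx'])
      have hD1 : ENNReal.ofReal (1 / 2 - η) ≤
          D {x | (labelled c S, (x, lab (labelled c S))) ∉ L} + ENNReal.ofReal η :=
        calc ENNReal.ofReal (1 / 2 - η) ≤ ENNReal.ofReal (D.real (c ⁻¹' {lab (labelled c S)})) :=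
              ENNReal.ofReal_le_ofReal hfreq.le
          _ = D (c ⁻¹' {lab (labelled c S)}) := ofReal_measureReal
          _ ≤ _ := (measure_mono hcover).trans (measure_union_le _ _)
          _ ≤ _ := by gcongr
      have hsplit : (1 - ε) / 2 = (1 / 2 - η) - η := by rw [hη]; ring
      rw [hsplit, ENNReal.ofReal_sub _ hηpos.le]
      exact tsub_le_iff_right.2 hD1
    refine (measure_mono hsub).trans ((measure_union_le _ _).trans ?_)
    calc _ ≤ ENNReal.ofReal δ + (ENNReal.ofReal (δ / 2) + ENNReal.ofReal (δ / 2)) :=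
          add_le_add (hAC c hc D inferInstance hD)
            ((measure_union_le _ _).trans (add_le_add (hbad y₀) (hbad y₁)))
      _ = ENNReal.ofReal (2 * δ) := by
          rw [← ENNReal.ofReal_add (by positivity) (by positivity),
            ← ENNReal.ofReal_add (by positivity) (by positivity)]
          congr 1
          ring

end Barely

end BarelyRobust

theorem mainTheorem5 {X Y : Type*} [MeasurableSpace X] [MeasurableSpace Y]
    [MeasurableSingletonClass Y] (hY : Nat.card Y = 2)
    (U : X → Set X) (hU : ∀ x, (U x).Nonempty)
    (C : Set (X → Y)) (hC : ∀ c ∈ C, Measurable c)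
    (ε₀ δ₀ : ℝ) (hε₀ : ε₀ = 1 / 3) (hδ₀ : δ₀ = 1 / 3) :
    (∀ β : ℝ, 0 < β → β ≤ 1 →
      BarelyRobust.BarelyRobustlyLearnable U β (β * ε₀ / 2) (β * δ₀ / Real.log (2 / ε₀)) C →
      BarelyRobust.RobustlyLearnable U ε₀ δ₀ C) ∧
    (∀ ε δ : ℝ, 0 < ε → ε < 1 → 0 < δ → δ < 1 →
      BarelyRobust.RobustlyLearnable U ε₀ δ₀ C →
      BarelyRobust.RobustlyLearnable U ε δ C) ∧
    (∀ ε δ : ℝ, 0 < ε → ε < 1 → 0 < δ → δ < 1 →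
      BarelyRobust.RobustlyLearnable U ε δ C →
      BarelyRobust.BarelyRobustlyLearnable U ((1 - ε) / 2) (2 * ε) (2 * δ) C) ∧
    (∀ β ε δ : ℝ, 0 < β → β ≤ 1 → 0 < ε → ε < 1 → 0 < δ → δ < 1 →
      BarelyRobust.BarelyRobustlyLearnable U β (β * ε₀ / 2) (β * δ₀ / Real.log (2 / ε₀)) C →
      BarelyRobust.BarelyRobustlyLearnable U ((1 - ε) / 2) (2 * ε) (2 * δ) C) := by
  subst hε₀ hδ₀
  have : Nonempty Y := by
    rw [← not_isEmpty_iff]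
    intro h
    simp at hY
  have hlog : 1 ≤ Real.log (2 / (1 / 3)) := by
    rw [Real.le_log_iff_exp_le (by norm_num)]
    linarith [Real.exp_one_lt_d9]
  have barely_weak : ∀ β : ℝ, 0 < β → β ≤ 1 →
      BarelyRobust.BarelyRobustlyLearnable U β (β * (1 / 3) / 2)
        (β * (1 / 3) / Real.log (2 / (1 / 3))) C →
      BarelyRobust.WeakCompression U (1 / 3) C := by
    intro β hβ hβ1 h
    rw [show β * (1 / 3 : ℝ) / 2 = β * (1 / 6) by ring] at h
    refine h.weakCompression hβ hβ1 (by norm_num) (by norm_num) ?_ (by norm_num)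
    rw [div_lt_one (by linarith)]
    linarith
  have weak_robust : ∀ ε δ θ : ℝ, 0 ≤ θ → θ < 1 / 2 → 0 < ε → ε < 1 → 0 < δ →
      BarelyRobust.WeakCompression U θ C → BarelyRobust.RobustlyLearnable U ε δ C := by
    intro ε δ θ hθ hθ2 hε hε1 hδ h
    obtain ⟨A, m, L, -, hL⟩ := h.robustlyLearnable hθ hθ2 hC hε hε1 hδ 0
    exact ⟨A, m, L, hL⟩
  refine ⟨fun β hβ hβ1 h => ?_, fun ε δ hε hε1 hδ _ h => ?_, fun ε δ hε hε1 hδ hδ1 h => ?_,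
    fun β ε δ hβ hβ1 hε hε1 hδ _ h => ?_⟩
  · exact weak_robust _ _ (1 / 3) (by norm_num) (by norm_num) (by norm_num) (by norm_num)
      (by norm_num) (barely_weak β hβ hβ1 h)
  · exact weak_robust _ _ (1 / 3) (by norm_num) (by norm_num) hε hε1 hδ
      (h.weakCompression (by norm_num) (by norm_num))
  · rcases le_or_gt (1 / 2) ε with hε2 | hε2
    · exact BarelyRobust.barelyRobustlyLearnable_of_one_le_error (by linarith) (by linarith) _
    · exact (h.weakCompression hε.le hδ1).barelyRobustlyLearnable hY hU hC hε.le hε2 hε hε1 hδ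
  · exact (barely_weak β hβ hβ1 h).barelyRobustlyLearnable hY hU hC (by norm_num) (by norm_num)
      hε hε1 hδ
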